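/- Let $n\ge 1$, let $A=(a_1,a_2,\ldots,a_n)$ be a row of integers with $1=a_1<a_2<\cdots<a_n$, and let $\beta\in\mathbf C$. Let $A_n=\mathbf C\langle x_1,\ldots,x_n,\partial_1,\ldots,\partial_n\rangle$ be the Weyl algebra, let $I_A\subset\mathbf C[\partial_1,\ldots,\partial_n]$ be the toric ideal generated by all $\partial^u-\partial^v$ with $u,v\in\mathbf N^n$ and $\sum_i a_iu_i=\sum_i a_iv_i$, and let $H_A(\beta)$ be the left ideal of $A_n$ generated by $I_A$ and $\sum_{i=1}^n a_ix_i\partial_i-\beta$. For a nonzero operator $P=\sum p_{\alpha\gamma}x^\alpha\partial^\gamma$ in $A_n$ let $\sigma(P)=\sum p_{\alpha\gamma}x^\alpha\xi^\gamma\in\mathbf C[x_1,\ldots,x_n,\xi_1,\ldots,\xi_n]$, the sum being over the terms of $P$ with $|\gamma|$ maximal. The characteristic variety of $A_n/I$, for a left ideal $I$ of $A_n$, is the set of common zeros in $\mathbf C^{2n}$ of all $\sigma(P)$, $0\neq P\in I$, and the singular locus of $A_n/I$ is the image, under the projection $(x,\xi)\mapsto x$, of the set of points of the characteristic variety with $\xi\ne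 0$. Then for every $\beta\in\mathbf C$ the characteristic variety of $\mathcal H_A(\beta)=A_n/H_A(\beta)$ is the affine variety $$\mathcal V(\xi_1,\ldots,\xi_{n-1},x_n\xi_n)\subset\mathbf C^{2n}$$ defined by the polynomials $\xi_1,\ldots,\xi_{n-1},x_n\xi_n$. In particular, the singular locus of $\mathcal H_A(\beta)$ is the hyperplane $\{x\in\mathbf C^n : x_n=0\}$. -/

import Mathlib

open MvPolynomial

noncomputable section

/-- Defining relations of the Weyl algebra on generators `x_i` (`Sum.inl i`) and `∂_i` (`Sum.inr i`). -/
inductive WeylRel (n : ℕ) :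
    FreeAlgebra ℂ (Fin n ⊕ Fin n) → FreeAlgebra ℂ (Fin n ⊕ Fin n) → Prop
  | x_comm (i j : Fin n) : WeylRel n
      (FreeAlgebra.ι ℂ (Sum.inl i) * FreeAlgebra.ι ℂ (Sum.inl j))
      (FreeAlgebra.ι ℂ (Sum.inl j) * FreeAlgebra.ι ℂ (Sum.inl i))
  | d_comm (i j : Fin n) : WeylRel n
      (FreeAlgebra.ι ℂ (Sum.inr i) * FreeAlgebra.ι ℂ (Sum.inr j))
      (FreeAlgebra.ι ℂ (Sum.inr j) * FreeAlgebra.ι ℂ (Sum.inr i))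
  | d_x (i j : Fin n) : WeylRel n
      (FreeAlgebra.ι ℂ (Sum.inr i) * FreeAlgebra.ι ℂ (Sum.inl j))
      (FreeAlgebra.ι ℂ (Sum.inl j) * FreeAlgebra.ι ℂ (Sum.inr i) + if i = j then 1 else 0)

/-- The Weyl algebra `A_n = ℂ⟨x_1, …, x_n, ∂_1, …, ∂_n⟩`. -/
abbrev WeylAlgebra (n : ℕ) : Type := RingQuot (WeylRel n)

namespace WeylAlgebra

/-- The generator `x_i`. -/
def x {n : ℕ} (i : Fin n) : WeylAlgebra n :=
  RingQuot.mkAlgHom ℂ (WeylRel n) (FreeAlgebra.ι ℂ (Sum.inl i))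

/-- The generator `∂_i`. -/
def d {n : ℕ} (i : Fin n) : WeylAlgebra n :=
  RingQuot.mkAlgHom ℂ (WeylRel n) (FreeAlgebra.ι ℂ (Sum.inr i))

/-- The `ℂ`-linear map `ℂ[x, ξ] → A_n` that sends `x^α ξ^β` to the normally ordered monomial
`x^α ∂^β`. In the polynomial ring `Sum.inl i` indexes `x_i` and `Sum.inr i` indexes `ξ_i`. -/
def normalOrder (n : ℕ) : MvPolynomial (Fin n ⊕ Fin n) ℂ →ₗ[ℂ] WeylAlgebra n :=
  (basisMonomials (Fin n ⊕ Fin n) ℂ).constr ℂ fun m =>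
    (List.ofFn fun i : Fin n => x i ^ m (Sum.inl i)).prod *
      (List.ofFn fun i : Fin n => d i ^ m (Sum.inr i)).prod

/-- The inclusion `ℂ[∂] → A_n` of the differential operators with constant coefficients. -/
def constCoeff (n : ℕ) : MvPolynomial (Fin n) ℂ →ₗ[ℂ] WeylAlgebra n :=
  normalOrder n ∘ₗ (rename Sum.inr).toLinearMap

/-- The order weight: `x_i` has weight `0` and `ξ_i` has weight `1`. -/
def orderWeight (n : ℕ) : Fin n ⊕ Fin n → ℕ := Sum.elim (fun _ => 0) (fun _ => 1)

/-- For `p = ∑ p_{αβ} x^α ξ^β`, the principal symbol of the operator `∑ p_{αβ} x^α ∂^β`: the sum of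
the terms for which `|β|` is maximal. -/
def principalSymbol {n : ℕ} (p : MvPolynomial (Fin n ⊕ Fin n) ℂ) :
    MvPolynomial (Fin n ⊕ Fin n) ℂ :=
  weightedHomogeneousComponent (orderWeight n) (weightedTotalDegree (orderWeight n) p) p

/-- The ideal of `gr A_n = ℂ[x, ξ]` (order filtration) generated by the principal symbols of the
elements of the left ideal `I`. -/
def symbolIdeal {n : ℕ} (I : Ideal (WeylAlgebra n)) : Ideal (MvPolynomial (Fin n ⊕ Fin n) ℂ) :=
  Ideal.span {q | ∃ p, normalOrder n p ∈ I ∧ q = principalSymbol p}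

/-- The characteristic variety, in `T^*ℂ^n = ℂ^{2n}`, of the left module `A_n / I`. -/
def charVariety {n : ℕ} (I : Ideal (WeylAlgebra n)) : Set (Fin n ⊕ Fin n → ℂ) :=
  zeroLocus ℂ (symbolIdeal I)

/-- The singular locus of `A_n / I`: the projection to `ℂ^n` of the part of the characteristic
variety that lies outside the zero section `ξ = 0`. -/
def singularLocus {n : ℕ} (I : Ideal (WeylAlgebra n)) : Set (Fin n → ℂ) :=
  (fun (z : Fin n ⊕ Fin n → ℂ) (i : Fin n) => z (Sum.inl i)) ''
    {z | z ∈ charVariety I ∧ ∃ i, z (Sum.inr i) ≠ 0}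

end WeylAlgebra

/-- The toric ideal `I_A` in `ℂ[∂_1, …, ∂_n]`. -/
def toricIdeal {d n : ℕ} (A : Matrix (Fin d) (Fin n) ℤ) : Ideal (MvPolynomial (Fin n) ℂ) :=
  Ideal.span {p | ∃ u v : Fin n →₀ ℕ,
    A.mulVec (fun i => (u i : ℤ)) = A.mulVec (fun i => (v i : ℤ)) ∧
      p = monomial u 1 - monomial v 1}

/-- The `k`-th entry `∑_i a_{ki} x_i ∂_i - β_k` of `Aθ - β`. -/
def eulerOperator {d n : ℕ} (A : Matrix (Fin d) (Fin n) ℤ) (β : Fin d → ℂ) (k : Fin d) :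
    WeylAlgebra n :=
  ∑ i, (A k i : ℂ) • (WeylAlgebra.x i * WeylAlgebra.d i) - algebraMap ℂ (WeylAlgebra n) (β k)

/-- The GKZ-hypergeometric left ideal `H_A(β)` of `A_n`. -/
def gkzIdeal {d n : ℕ} (A : Matrix (Fin d) (Fin n) ℤ) (β : Fin d → ℂ) : Ideal (WeylAlgebra n) :=
  Ideal.span (WeylAlgebra.constCoeff n '' (toricIdeal A : Set (MvPolynomial (Fin n) ℂ)) ∪
    Set.range (eulerOperator A β))

end

/-! Write b for A as natural numbers and S = ∑ b-th terms x_i t^{b_i}. One inclusion is direct: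
∂_i^{b_n} - ∂_n^{b_i} and the Euler operator have symbols ξ_i^{b_n} and ∑ a_i x_i ξ_i, which cut the
variety down to ξ_1 = ⋯ = ξ_{n-1} = x_n ξ_n = 0.

The converse must control the symbol of every P in H_A(β); no Gröbner basis is used. Let the Weyl
algebra act on ℂ[x,t]·exp(S), so that ∂_i acts on the coefficient as ∂/∂x_i + t^{b_i}, and let E be
the conjugate of t∂_t - β by exp(S). E commutes with the action, so its range is a submodule. Toric
operators kill 1 and the Euler operator sends 1 to E(1), hence P·1 lies in range E
(`expAction_gkzIdeal_one`).

If P has normally ordered form p(x,∂) of order N, then P·1 = p(x, t^b). Its coefficient at t^{b_n N}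
is the coefficient of ξ_n^N in p, that is, the principal symbol restricted to ξ_1 = ⋯ = ξ_{n-1} = 0
(`aeval_principalSymbol`). But E(F) = tF' + eF, where e has t-leading term b_n x_n t^{b_n}; so that
coefficient is divisible by x_n, and is zero if N = 0. -/

noncomputable section

/-- Partial derivatives of polynomials commute. -/
theorem MvPolynomial.pderiv_comm {σ R : Type*} [CommRing R] (i j : σ) (f : MvPolynomial σ R) :
    pderiv i (pderiv j f) = pderiv j (pderiv i f) := by
  classical
  have h : ⁅pderiv (R := R) i, pderiv (R := R) j⁆ = 0 := by
    refine derivation_ext fun k => ?_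
    rw [Derivation.commutator_apply, pderiv_X, pderiv_X]
    simp [Pi.single_apply, apply_ite]
  have := congrArg (fun D => D f) h
  rw [Derivation.commutator_apply] at this
  exact sub_eq_zero.mp this

/-- The `t`-derivative corresponds to the derivative under `ℂ[x, t] ≃ ℂ[x][t]`. -/
theorem MvPolynomial.optionEquivLeft_pderiv_none {σ R : Type*} [CommRing R]
    (f : MvPolynomial (Option σ) R) :
    optionEquivLeft R σ (pderiv none f) = Polynomial.derivative (optionEquivLeft R σ f) := by
  classical
  induction f using MvPolynomial.induction_on with
  | C r => simp [optionEquivLeft_C]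
  | add p q hp hq => simp [hp, hq]
  | mul_X p i hp =>
    cases i with
    | none => simp [hp, Derivation.leibniz, optionEquivLeft_X_none]; ring
    | some i => simp [hp, Derivation.leibniz, optionEquivLeft_X_some, pderiv_X]; ring

/-! ### The Weyl algebra acting on ℂ[x,t]·exp(S) -/

namespace WeylAlgebra

variable {k : ℕ}

/-- The operator on `ℂ[x, t]` (with `t = X none`) through which `∂_i` acts on
`ℂ[x, t] · exp (∑ i, x_i t ^ b_i)`. -/
def twistedDeriv (b : Fin k → ℕ) (i : Fin k) : Module.End ℂ (MvPolynomial (Option (Fin k)) ℂ) :=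
  (pderiv (some i)).toLinearMap + Algebra.lmul ℂ _ (X none ^ b i)

theorem twistedDeriv_apply (b : Fin k → ℕ) (i : Fin k) (f : MvPolynomial (Option (Fin k)) ℂ) :
    twistedDeriv b i f = pderiv (some i) f + X none ^ b i * f := rfl

theorem pderiv_some_X_none_pow (i : Fin k) (m : ℕ) :
    pderiv (some i) (X none ^ m : MvPolynomial (Option (Fin k)) ℂ) = 0 := by
  rw [pderiv_pow, pderiv_X_of_ne (by simp), mul_zero]

/-- The action of the Weyl algebra on `ℂ[x, t] · exp (∑ i, x_i t ^ b_i)`. -/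
def expAction (b : Fin k → ℕ) :
    WeylAlgebra k →ₐ[ℂ] Module.End ℂ (MvPolynomial (Option (Fin k)) ℂ) :=
  RingQuot.liftAlgHom ℂ ⟨FreeAlgebra.lift ℂ
    (Sum.elim (fun i => Algebra.lmul ℂ _ (X (some i))) (twistedDeriv b)), by
    classical
    intro p q h
    induction h with
    | x_comm i j =>
      simp only [map_mul, FreeAlgebra.lift_ι_apply, Sum.elim_inl]
      rw [← map_mul, mul_comm, map_mul]
    | d_comm i j =>
      simp only [map_mul, FreeAlgebra.lift_ι_apply, Sum.elim_inr]
      refine LinearMap.ext fun f => ?_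
      simp only [Module.End.mul_apply, twistedDeriv_apply, map_add, pderiv_mul,
        pderiv_some_X_none_pow]
      rw [pderiv_comm]
      ring
    | d_x i j =>
      simp only [map_mul, map_add, FreeAlgebra.lift_ι_apply, Sum.elim_inr, Sum.elim_inl]
      refine LinearMap.ext fun f => ?_
      by_cases hij : i = j
      · subst hij
        simp [twistedDeriv_apply]
        ring
      · have : (some j : Option (Fin k)) ≠ some i := by simpa using Ne.symm hij
        simp [twistedDeriv_apply, hij, pderiv_X_of_ne this]
        ring⟩

theorem expAction_x (b : Fin k → ℕ) (i : Fin k) :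
    expAction b (x i) = Algebra.lmul ℂ _ (X (some i)) := by
  simp [expAction, x]

theorem expAction_d (b : Fin k → ℕ) (i : Fin k) : expAction b (d i) = twistedDeriv b i := by
  simp [expAction, d]

theorem twistedDeriv_pow_X_none_pow (b : Fin k → ℕ) (i : Fin k) (m r : ℕ) :
    (twistedDeriv b i ^ m) (X none ^ r) = (X none ^ b i) ^ m * X none ^ r := by
  induction m with
  | zero => simp
  | succ m ih =>
    rw [pow_succ', Module.End.mul_apply, ih, ← pow_mul, ← pow_add, twistedDeriv_apply,
      pderiv_some_X_none_pow]
    ring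

theorem prod_twistedDeriv_pow_one (b : Fin k → ℕ) (m : Fin k → ℕ) (l : List (Fin k)) :
    ((l.map fun i => twistedDeriv b i ^ m i).prod) 1 =
      (l.map fun i => (X none ^ b i : MvPolynomial (Option (Fin k)) ℂ) ^ m i).prod := by
  have h : ∀ l : List (Fin k), ∃ r, (l.map fun i =>
      (X none ^ b i : MvPolynomial (Option (Fin k)) ℂ) ^ m i).prod = X none ^ r := by
    intro l
    induction l with
    | nil => exact ⟨0, by simp⟩
    | cons i l ih =>
      obtain ⟨r, hr⟩ := ih
      exact ⟨b i * m i + r, by rw [List.map_cons, List.prod_cons, hr]; ring⟩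
  induction l with
  | nil => simp
  | cons i l ih =>
    obtain ⟨r, hr⟩ := h l
    rw [List.map_cons, List.prod_cons, Module.End.mul_apply, ih, hr, twistedDeriv_pow_X_none_pow,
      List.map_cons, List.prod_cons, hr]

theorem normalOrder_monomial (m : Fin k ⊕ Fin k →₀ ℕ) (c : ℂ) :
    normalOrder k (monomial m c) = c • ((List.ofFn fun i : Fin k => x i ^ m (Sum.inl i)).prod *
      (List.ofFn fun i : Fin k => d i ^ m (Sum.inr i)).prod) := by
  have : monomial m c = c • basisMonomials (Fin k ⊕ Fin k) ℂ m := by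
    simp [smul_monomial]
  rw [this, map_smul, normalOrder, Module.Basis.constr_basis]

/-- The substitution `x_i ↦ x_i`, `ξ_i ↦ t ^ b_i`. -/
def curveSubst (b : Fin k → ℕ) :
    MvPolynomial (Fin k ⊕ Fin k) ℂ →ₐ[ℂ] MvPolynomial (Option (Fin k)) ℂ :=
  aeval (Sum.elim (fun i => X (some i)) (fun i => X none ^ b i))

theorem curveSubst_monomial (b : Fin k → ℕ) (m : Fin k ⊕ Fin k →₀ ℕ) (c : ℂ) :
    curveSubst b (monomial m c) =
      C c * ((∏ i, X (some i) ^ m (Sum.inl i)) * ∏ i, (X none ^ b i) ^ m (Sum.inr i)) := by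
  rw [curveSubst, aeval_monomial, Finsupp.prod_fintype _ _ (by simp), Fintype.prod_sum_type]
  rfl

/-- In normal order the ∂'s act first; on powers of t they are multiplication by t^{b_i}, since
∂/∂x_i kills t. No derivative ever meets an x. -/
theorem expAction_normalOrder_one (b : Fin k → ℕ) (p : MvPolynomial (Fin k ⊕ Fin k) ℂ) :
    expAction b (normalOrder k p) 1 = curveSubst b p := by
  induction p using MvPolynomial.induction_on' with
  | add p q hp hq => simp [hp, hq]
  | monomial m c =>
    have hx : expAction b (List.ofFn fun i : Fin k => x i ^ m (Sum.inl i)).prod =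
        Algebra.lmul ℂ _ (∏ i, X (some i) ^ m (Sum.inl i)) := by
      rw [map_list_prod, ← List.prod_ofFn, map_list_prod, List.map_ofFn, List.map_ofFn]
      congr 2
      funext i
      simp only [Function.comp_apply, map_pow, expAction_x]
    have hd : expAction b (List.ofFn fun i : Fin k => d i ^ m (Sum.inr i)).prod 1 =
        ∏ i, (X none ^ b i) ^ m (Sum.inr i) := by
      rw [map_list_prod, ← List.prod_ofFn, List.map_ofFn, List.ofFn_eq_map, List.ofFn_eq_map,
        ← prod_twistedDeriv_pow_one]
      congr 3
      funext i
      simp only [Function.comp_apply, map_pow, expAction_d]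
    rw [normalOrder_monomial, map_smul, map_mul, LinearMap.smul_apply, Module.End.mul_apply, hd, hx,
      curveSubst_monomial, smul_eq_C_mul]
    rfl

/-! ### The Euler endomorphism and its leading term in t -/

/-- The endomorphism `t ∂_t + ∑ i, b_i x_i t ^ b_i - β` of `ℂ[x, t]`. -/
def eulerEnd (b : Fin k → ℕ) (β : ℂ) : Module.End ℂ (MvPolynomial (Option (Fin k)) ℂ) :=
  Algebra.lmul ℂ _ (X none) * (pderiv none).toLinearMap +
    Algebra.lmul ℂ _ (∑ i, C (b i : ℂ) * (X (some i) * X none ^ b i) - C β)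

theorem eulerEnd_apply (b : Fin k → ℕ) (β : ℂ) (f : MvPolynomial (Option (Fin k)) ℂ) :
    eulerEnd b β f = X none * pderiv none f +
      (∑ i, C (b i : ℂ) * (X (some i) * X none ^ b i) - C β) * f := rfl

theorem X_none_mul_pderiv_none_pow (r : ℕ) :
    (X none : MvPolynomial (Option (Fin k)) ℂ) * pderiv none (X none ^ r) =
      C (r : ℂ) * X none ^ r := by
  rw [pderiv_pow, pderiv_X_self]
  cases r with
  | zero => simp
  | succ r => simp; ring

/-- Undoing the conjugation by exp(S) leaves t∂_t - β and operators in x alone, which commute. It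
suffices to check generators. -/
theorem commute_eulerEnd_expAction (b : Fin k → ℕ) (β : ℂ) (P : WeylAlgebra k) :
    Commute (eulerEnd b β) (expAction b P) := by
  classical
  obtain ⟨p, rfl⟩ := RingQuot.mkAlgHom_surjective ℂ (WeylRel k) P
  induction p using FreeAlgebra.induction with
  | grade0 r =>
    rw [AlgHom.commutes, AlgHom.commutes]
    exact (Algebra.commutes r _).symm
  | grade1 s =>
    cases s with
    | inl i =>
      change Commute _ (expAction b (x i))
      rw [expAction_x]
      refine LinearMap.ext fun f => ?_
      have : pderiv none (X (some i) : MvPolynomial (Option (Fin k)) ℂ) = 0 :=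
        pderiv_X_of_ne (by simp)
      simp only [Module.End.mul_apply, eulerEnd_apply, Algebra.coe_lmul_eq_mul,
        LinearMap.mul_apply', pderiv_mul, this]
      ring
    | inr i =>
      change Commute _ (expAction b (d i))
      rw [expAction_d]
      refine LinearMap.ext fun f => ?_
      have hX : pderiv (some i) (X none : MvPolynomial (Option (Fin k)) ℂ) = 0 :=
        pderiv_X_of_ne (by simp)
      have hs : pderiv (some i) (∑ j, C (b j : ℂ) * (X (some j) * X none ^ b j) - C β :
          MvPolynomial (Option (Fin k)) ℂ) = C (b i : ℂ) * X none ^ b i := by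
        rw [map_sub, map_sum, pderiv_C, sub_zero, Finset.sum_eq_single i]
        · simp
        · intro j _ hj
          rw [pderiv_C_mul, pderiv_mul, pderiv_some_X_none_pow, pderiv_X_of_ne (by simpa using hj)]
          simp
        · simp
      have ht := X_none_mul_pderiv_none_pow (k := k) (b i)
      simp only [Module.End.mul_apply, eulerEnd_apply, twistedDeriv_apply, map_add,
        pderiv_mul (i := some i), pderiv_mul (i := none), hX, hs, pderiv_comm none (some i)]
      -- The only discrepancy is t∂_t(t^{b_i}) = b_i t^{b_i}, from differentiating S in t and x_i.
      linear_combination f * ht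
  | mul p q hp hq => rw [map_mul, map_mul]; exact hp.mul_right hq
  | add p q hp hq => rw [map_add, map_add]; exact hp.add_right hq

end WeylAlgebra

/-- The leading coefficient of `e` divides that of `X F' + e F`. -/
theorem Polynomial.leadingCoeff_dvd_coeff_X_mul_derivative_add {R : Type*} [CommRing R]
    [IsDomain R] {e : Polynomial R} (he : 0 < e.natDegree) (F : Polynomial R) {N : ℕ}
    (hN : (X * derivative F + e * F).natDegree ≤ N) :
    e.leadingCoeff ∣ (X * derivative F + e * F).coeff N ∧
      (N = 0 → (X * derivative F + e * F).coeff N = 0) := by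
  rcases eq_or_ne F 0 with rfl | hF
  · simp
  have he0 : e ≠ 0 := by rintro rfl; simp at he
  have hX : (X * derivative F).natDegree ≤ F.natDegree := by
    by_cases h : F.natDegree = 0
    · rw [derivative_of_natDegree_zero h]; simp
    · have := natDegree_derivative_lt h
      have := natDegree_mul_le (p := X) (q := derivative F)
      rw [natDegree_X] at this
      omega
  have hmul : (e * F).natDegree = e.natDegree + F.natDegree := natDegree_mul he0 hF
  have hdeg : (X * derivative F + e * F).natDegree = e.natDegree + F.natDegree := by
    rw [natDegree_add_eq_right_of_natDegree_lt (by omega), hmul]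
  rw [hdeg] at hN
  -- As e has positive degree, eF alone determines the top term. Either N is that degree, which is
  -- then positive, or the coefficient is zero.
  rcases hN.eq_or_lt with rfl | h
  · refine ⟨?_, by omega⟩
    rw [coeff_add, coeff_eq_zero_of_natDegree_lt (p := X * derivative F) (by omega), zero_add,
      coeff_mul_degree_add_degree]
    exact dvd_mul_right _ _
  · rw [coeff_eq_zero_of_natDegree_lt (by omega)]
    simp

namespace WeylAlgebra

theorem optionEquivLeft_eulerEnd {k : ℕ} (b : Fin k → ℕ) (β : ℂ)
    (f : MvPolynomial (Option (Fin k)) ℂ) :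
    optionEquivLeft ℂ (Fin k) (eulerEnd b β f) =
      Polynomial.X * Polynomial.derivative (optionEquivLeft ℂ (Fin k) f) +
      (∑ i, Polynomial.C (C (b i : ℂ) * X i) * Polynomial.X ^ b i - Polynomial.C (C β)) *
        optionEquivLeft ℂ (Fin k) f := by
  rw [eulerEnd_apply, map_add, map_mul, map_mul, optionEquivLeft_pderiv_none,
    optionEquivLeft_X_none, map_sub, map_sum, optionEquivLeft_C]
  simp only [map_mul, map_pow, optionEquivLeft_C, optionEquivLeft_X_none, optionEquivLeft_X_some,
    mul_assoc]

theorem natDegree_leadingCoeff_eulerPolynomial {n : ℕ} {b : Fin (n + 1) → ℕ} (hb : StrictMono b)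
    (h0 : 0 < b 0) (β : ℂ) :
    (∑ i, Polynomial.C (C (b i : ℂ) * X i : MvPolynomial (Fin (n + 1)) ℂ) * Polynomial.X ^ b i -
      Polynomial.C (C β)).natDegree = b (Fin.last n) ∧
    (∑ i, Polynomial.C (C (b i : ℂ) * X i : MvPolynomial (Fin (n + 1)) ℂ) * Polynomial.X ^ b i -
      Polynomial.C (C β)).leadingCoeff = C (b (Fin.last n) : ℂ) * X (Fin.last n) := by
  have hpos : 0 < b (Fin.last n) := h0.trans_le (hb.monotone (Fin.zero_le _))
  set e := ∑ i, Polynomial.C (C (b i : ℂ) * X i : MvPolynomial (Fin (n + 1)) ℂ) *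
    Polynomial.X ^ b i - Polynomial.C (C β) with he
  have hle : e.natDegree ≤ b (Fin.last n) := by
    refine (Polynomial.natDegree_sub_le _ _).trans (max_le ?_ (by simp))
    exact Polynomial.natDegree_sum_le_of_forall_le _ _ fun i _ =>
      (Polynomial.natDegree_C_mul_X_pow_le _ _).trans (hb.monotone (Fin.le_last i))
  have hc : e.coeff (b (Fin.last n)) = C (b (Fin.last n) : ℂ) * X (Fin.last n) := by
    rw [he, Polynomial.coeff_sub, Polynomial.coeff_C_of_ne_zero hpos.ne', sub_zero,
      Polynomial.finsetSum_coeff, Finset.sum_eq_single (Fin.last n)]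
    · rw [Polynomial.coeff_C_mul_X_pow, if_pos rfl]
    · intro i _ hi
      rw [Polynomial.coeff_C_mul_X_pow, if_neg (hb.injective.ne hi.symm)]
    · simp
  have hne : e.coeff (b (Fin.last n)) ≠ 0 := by
    rw [hc]
    refine mul_ne_zero ?_ (X_ne_zero _)
    simpa using hpos.ne'
  have hd := le_antisymm hle (Polynomial.le_natDegree_of_ne_zero hne)
  exact ⟨hd, by rw [Polynomial.leadingCoeff, hd, hc]⟩

/-! ### Principal symbols read off from the t-degree -/

theorem weight_orderWeight {k : ℕ} (m : Fin k ⊕ Fin k →₀ ℕ) :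
    Finsupp.weight (orderWeight k) m = ∑ i, m (Sum.inr i) := by
  rw [Finsupp.weight_apply, Finsupp.sum_fintype _ _ (by simp), Fintype.sum_sum_type]
  simp [orderWeight]

theorem optionEquivLeft_curveSubst_monomial {k : ℕ} (b : Fin k → ℕ) (m : Fin k ⊕ Fin k →₀ ℕ)
    (c : ℂ) : optionEquivLeft ℂ (Fin k) (curveSubst b (monomial m c)) =
      Polynomial.C (C c * ∏ i, X i ^ m (Sum.inl i)) *
        Polynomial.X ^ (∑ i, b i * m (Sum.inr i)) := by
  rw [curveSubst_monomial]
  simp only [map_mul, map_prod, map_pow, optionEquivLeft_C, optionEquivLeft_X_none,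
    optionEquivLeft_X_some, ← pow_mul, Finset.prod_pow_eq_pow_sum, mul_assoc]

section

variable {n : ℕ} {b : Fin (n + 1) → ℕ}

theorem sum_mul_le (hb : StrictMono b) (m : Fin (n + 1) → ℕ) :
    ∑ i, b i * m i ≤ b (Fin.last n) * ∑ i, m i := by
  rw [Finset.mul_sum]
  exact Finset.sum_le_sum fun i _ => Nat.mul_le_mul_right _ (hb.monotone (Fin.le_last i))

theorem sum_mul_lt (hb : StrictMono b) (m : Fin (n + 1) → ℕ) {j : Fin (n + 1)}
    (hj : j ≠ Fin.last n) (hm : m j ≠ 0) :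
    ∑ i, b i * m i < b (Fin.last n) * ∑ i, m i := by
  rw [Finset.mul_sum]
  exact Finset.sum_lt_sum (fun i _ => Nat.mul_le_mul_right _ (hb.monotone (Fin.le_last i)))
    ⟨j, Finset.mem_univ _, Nat.mul_lt_mul_of_pos_right (hb (Fin.lt_last_iff_ne_last.mpr hj))
      (Nat.pos_of_ne_zero hm)⟩

theorem natDegree_curveSubst_le (hb : StrictMono b)
    (p : MvPolynomial (Fin (n + 1) ⊕ Fin (n + 1)) ℂ) :
    (optionEquivLeft ℂ (Fin (n + 1)) (curveSubst b p)).natDegree ≤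
      b (Fin.last n) * weightedTotalDegree (orderWeight (n + 1)) p := by
  nth_rewrite 1 [p.as_sum]
  rw [map_sum, map_sum]
  refine Polynomial.natDegree_sum_le_of_forall_le _ _ fun m hm => ?_
  rw [optionEquivLeft_curveSubst_monomial]
  refine (Polynomial.natDegree_C_mul_X_pow_le _ _).trans ((sum_mul_le hb _).trans ?_)
  rw [← weight_orderWeight]
  exact Nat.mul_le_mul_left _ (le_weightedTotalDegree _ hm)

/-- Since b_n is the strict maximum, a monomial of p reaches t^{b_n N} only if its ξ-part is exactly
ξ_n^N. -/
theorem aeval_principalSymbol (hb : StrictMono b) (h0 : 0 < b 0)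
    (p : MvPolynomial (Fin (n + 1) ⊕ Fin (n + 1)) ℂ)
    {z : Fin (n + 1) ⊕ Fin (n + 1) → ℂ} (hz : ∀ i, i ≠ Fin.last n → z (Sum.inr i) = 0) :
    aeval z (principalSymbol p) =
      aeval (fun i => z (Sum.inl i)) ((optionEquivLeft ℂ (Fin (n + 1)) (curveSubst b p)).coeff
        (b (Fin.last n) * weightedTotalDegree (orderWeight (n + 1)) p)) *
      z (Sum.inr (Fin.last n)) ^ weightedTotalDegree (orderWeight (n + 1)) p := by
  have hpos : 0 < b (Fin.last n) := h0.trans_le (hb.monotone (Fin.zero_le _))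
  rw [principalSymbol]
  set N := weightedTotalDegree (orderWeight (n + 1)) p with hN
  have hp : ∀ m ∈ p.support, ∑ i, m (Sum.inr i) ≤ N := fun m hm => by
    rw [← weight_orderWeight]; exact le_weightedTotalDegree _ hm
  clear_value N
  rw [p.as_sum]
  simp only [map_sum, Polynomial.finsetSum_coeff, Finset.sum_mul]
  refine Finset.sum_congr rfl fun m hm => ?_
  have hmN := hp m hm
  rw [optionEquivLeft_curveSubst_monomial, Polynomial.coeff_C_mul_X_pow,
    weightedHomogeneousComponent_of_mem (isWeightedHomogeneous_monomial _ m _ rfl),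
    weight_orderWeight]
  by_cases hall : ∀ j, j ≠ Fin.last n → m (Sum.inr j) = 0
  · have hs : ∑ i, m (Sum.inr i) = m (Sum.inr (Fin.last n)) :=
      Finset.sum_eq_single _ (fun j _ hj => hall j hj) (by simp)
    have hbs : ∑ i, b i * m (Sum.inr i) = b (Fin.last n) * m (Sum.inr (Fin.last n)) :=
      Finset.sum_eq_single _ (fun j _ hj => by rw [hall j hj, mul_zero]) (by simp)
    rw [hs, hbs]
    by_cases hNm : N = m (Sum.inr (Fin.last n))
    · rw [if_pos hNm, if_pos (by rw [hNm]), aeval_monomial, Finsupp.prod_fintype _ _ (by simp),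
        Fintype.prod_sum_type, Finset.prod_eq_single (Fin.last n)
          (f := fun i => z (Sum.inr i) ^ m (Sum.inr i)), hNm]
      · simp [mul_assoc]
      · intro j _ hj
        rw [hall j hj, pow_zero]
      · simp
    · rw [if_neg hNm, if_neg fun h => hNm (Nat.eq_of_mul_eq_mul_left hpos h)]
      simp
  -- A factor ξ_j with j ≠ n makes the t-degree too small on the right and gives zero at z on the
  -- left.
  · push Not at hall
    obtain ⟨j, hj, hmj⟩ := hall
    have hlt := (sum_mul_lt hb (fun i => m (Sum.inr i)) hj hmj).trans_le
      (Nat.mul_le_mul_left _ hmN)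
    rw [if_neg hlt.ne', map_zero, zero_mul]
    split_ifs
    · rw [aeval_monomial, Finsupp.prod_fintype _ _ (by simp),
        Finset.prod_eq_zero (Finset.mem_univ (Sum.inr j)), mul_zero]
      rw [hz j hj, zero_pow hmj]
    · simp

/-- An operator carrying `1` into the range of the Euler endomorphism has a principal symbol that
vanishes on `ξ_1 = ⋯ = ξ_{n-1} = x_n ξ_n = 0`. -/
theorem aeval_principalSymbol_eq_zero (hb : StrictMono b) (h0 : 0 < b 0) (β : ℂ)
    {p : MvPolynomial (Fin (n + 1) ⊕ Fin (n + 1)) ℂ}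
    (hp : expAction b (normalOrder (n + 1) p) 1 ∈ (eulerEnd b β).range)
    {z : Fin (n + 1) ⊕ Fin (n + 1) → ℂ} (hz : ∀ i, i ≠ Fin.last n → z (Sum.inr i) = 0)
    (hz' : z (Sum.inl (Fin.last n)) * z (Sum.inr (Fin.last n)) = 0) :
    aeval z (principalSymbol p) = 0 := by
  obtain ⟨f, hf⟩ := hp
  rw [expAction_normalOrder_one] at hf
  obtain ⟨hd, hl⟩ := natDegree_leadingCoeff_eulerPolynomial hb h0 β
  have hpos : 0 < b (Fin.last n) := h0.trans_le (hb.monotone (Fin.zero_le _))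
  have hdeg := natDegree_curveSubst_le hb p
  rw [aeval_principalSymbol hb h0 p hz]
  rw [← hf, optionEquivLeft_eulerEnd] at hdeg ⊢
  obtain ⟨h1, h2⟩ := Polynomial.leadingCoeff_dvd_coeff_X_mul_derivative_add (by rw [hd]; exact hpos)
    _ hdeg
  rcases Nat.eq_zero_or_pos (weightedTotalDegree (orderWeight (n + 1)) p) with hN | hN
  · rw [h2 (by rw [hN, mul_zero]), map_zero, zero_mul]
  · rw [hl] at h1
    obtain ⟨q, hq⟩ := h1
    rw [hq]
    rcases mul_eq_zero.mp hz' with h | h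
    · simp [h]
    · rw [h, zero_pow hN.ne', mul_zero]

end

end WeylAlgebra

/-! ### Generators of H_A(β), their action on 1 and their symbols -/

theorem List.prod_ofFn_eq_single {k : ℕ} {M : Type*} [Monoid M] {f : Fin k → M} (i : Fin k)
    (h : ∀ j, j ≠ i → f j = 1) : (List.ofFn f).prod = f i := by
  induction k with
  | zero => exact i.elim0
  | succ k ih =>
    rw [List.ofFn_succ, List.prod_cons]
    cases i using Fin.cases with
    | zero =>
      rw [funext fun j => h (Fin.succ j) (Fin.succ_ne_zero j)]
      simp
    | succ i =>
      rw [h 0 (Fin.succ_ne_zero i).symm, one_mul,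
        ih i fun j hj => h j.succ ((Fin.succ_injective k).ne hj)]

namespace WeylAlgebra

/-- The principal symbol of a sum of two forms of different orders. -/
theorem principalSymbol_add {k : ℕ} {q r : MvPolynomial (Fin k ⊕ Fin k) ℂ} {m m' : ℕ}
    (hq : IsWeightedHomogeneous (orderWeight k) q m)
    (hr : IsWeightedHomogeneous (orderWeight k) r m') (h : m' < m) (hq0 : q ≠ 0) :
    principalSymbol (q + r) = q := by
  have hcoeff : ∀ s, coeff s q ≠ 0 → coeff s (q + r) = coeff s q := fun s hs => by
    rw [coeff_add, hr.coeff_eq_zero s (by rw [hq hs]; exact h.ne'), add_zero]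
  have hd : weightedTotalDegree (orderWeight k) (q + r) = m := by
    refine le_antisymm (Finset.sup_le fun s hs => ?_) ?_
    · by_cases hs' : coeff s q = 0
      · rw [mem_support_iff, coeff_add, hs', zero_add] at hs
        exact (hr hs).trans_le h.le
      · exact (hq hs').le
    · obtain ⟨s, hs⟩ := exists_coeff_ne_zero hq0
      rw [← hq hs]
      exact le_weightedTotalDegree _ (mem_support_iff.mpr (by rwa [hcoeff s hs]))
  rw [principalSymbol, hd, map_add, hq.weightedHomogeneousComponent_same,
    hr.weightedHomogeneousComponent_ne _ h.ne', add_zero]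

theorem normalOrder_X_mul_X {k : ℕ} (i : Fin k) :
    normalOrder k (X (Sum.inl i) * X (Sum.inr i)) = x i * d i := by
  classical
  have h : (X (Sum.inl i) * X (Sum.inr i) : MvPolynomial (Fin k ⊕ Fin k) ℂ) =
      monomial (Finsupp.single (Sum.inl i) 1 + Finsupp.single (Sum.inr i) 1) 1 := by
    rw [X, X, monomial_mul, one_mul]
  rw [h, normalOrder_monomial, one_smul]
  rw [List.prod_ofFn_eq_single i fun j hj => by simp [hj.symm],
    List.prod_ofFn_eq_single i fun j hj => by simp [hj.symm]]
  simp

theorem normalOrder_C {k : ℕ} (c : ℂ) : normalOrder k (C c) = algebraMap ℂ (WeylAlgebra k) c := by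
  rw [C_apply, normalOrder_monomial]
  simp [Algebra.algebraMap_eq_smul_one]

end WeylAlgebra

open WeylAlgebra

theorem eulerOperator_eq_normalOrder {m k : ℕ} (A : Matrix (Fin m) (Fin k) ℤ) (β : Fin m → ℂ)
    (j : Fin m) : eulerOperator A β j = normalOrder k
      (∑ i, C (A j i : ℂ) * (X (Sum.inl i) * X (Sum.inr i)) + C (-β j)) := by
  rw [eulerOperator, map_add, map_sum, normalOrder_C, map_neg, sub_eq_add_neg]
  simp only [← smul_eq_C_mul, map_smul, normalOrder_X_mul_X]

/-- The left ideal `H_A(β)` carries `1` into the range of the Euler endomorphism. -/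
theorem expAction_gkzIdeal_one {k : ℕ} {a : Fin k → ℤ} {b : Fin k → ℕ} (hab : ∀ i, (b i : ℤ) = a i)
    (β : ℂ) {P : WeylAlgebra k}
    (hP : P ∈ gkzIdeal (Matrix.of fun (_ : Fin 1) (j : Fin k) => a j) (fun _ => β)) :
    expAction b P 1 ∈ (eulerEnd b β).range := by
  rw [gkzIdeal] at hP
  induction hP using Submodule.span_induction with
  | mem P hP =>
    rcases hP with ⟨p, hp, rfl⟩ | ⟨j, rfl⟩
    · have h : toricIdeal (Matrix.of fun (_ : Fin 1) (j : Fin k) => a j) ≤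
          RingHom.ker ((curveSubst b).comp (rename Sum.inr)) := by
        rw [toricIdeal, Ideal.span_le]
        rintro _ ⟨u, v, huv, rfl⟩
        have hsum : ∑ i, b i * u i = ∑ i, b i * v i := by
          have := congrFun huv 0
          simp only [Matrix.mulVec, dotProduct, Matrix.of_apply, ← hab] at this
          exact_mod_cast this
        have hmon : ∀ w : Fin k →₀ ℕ, (curveSubst b).comp (rename Sum.inr) (monomial w 1) =
            X none ^ ∑ i, b i * w i := by
          intro w
          rw [AlgHom.comp_apply, curveSubst, aeval_rename, aeval_monomial,
            Finsupp.prod_fintype _ _ (by simp)]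
          simp [← pow_mul, Finset.prod_pow_eq_pow_sum]
        rw [SetLike.mem_coe, RingHom.mem_ker, map_sub, hmon, hmon, hsum, sub_self]
      have := h hp
      rw [RingHom.mem_ker, AlgHom.comp_apply] at this
      rw [constCoeff, LinearMap.comp_apply, expAction_normalOrder_one, AlgHom.toLinearMap_apply,
        this]
      exact zero_mem _
    -- The t-derivative of 1 vanishes, so E(1) = ∑ b_i x_i t^{b_i} - β, which is also the Euler
    -- operator applied to 1.
    · refine ⟨1, ?_⟩
      rw [eulerOperator_eq_normalOrder, expAction_normalOrder_one, eulerEnd_apply]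
      simp [curveSubst, ← hab, sub_eq_add_neg]
  | zero => simp
  | add P Q _ _ hP hQ => rw [map_add]; exact add_mem hP hQ
  | smul P Q _ hQ =>
    obtain ⟨f, hf⟩ := hQ
    -- P·E(f) = E(P·f) by commutation.
    refine ⟨expAction b P f, ?_⟩
    rw [smul_eq_mul, map_mul, Module.End.mul_apply, ← hf]
    exact LinearMap.congr_fun (commute_eulerEnd_expAction b β P) f

/-- The symbol of `∂_i ^ a_n - ∂_n ^ a_i` lies in the symbol ideal of `H_A(β)`. -/
theorem X_inr_pow_mem_symbolIdeal {n : ℕ} {a : Fin (n + 1) → ℤ} {b : Fin (n + 1) → ℕ}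
    (hab : ∀ i, (b i : ℤ) = a i) (hb : StrictMono b) (β : Fin 1 → ℂ) {i : Fin (n + 1)}
    (hi : i ≠ Fin.last n) :
    (X (Sum.inr i) : MvPolynomial (Fin (n + 1) ⊕ Fin (n + 1)) ℂ) ^ b (Fin.last n) ∈
      symbolIdeal (gkzIdeal (Matrix.of fun (_ : Fin 1) (j : Fin (n + 1)) => a j) β) := by
  have hX : ∀ j r, IsWeightedHomogeneous (orderWeight (n + 1)) (X (Sum.inr j) ^ r :
      MvPolynomial (Fin (n + 1) ⊕ Fin (n + 1)) ℂ) r := fun j r => by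
    simpa [orderWeight] using (isWeightedHomogeneous_X ℂ (orderWeight (n + 1)) (Sum.inr j)).pow r
  refine Ideal.subset_span ⟨X (Sum.inr i) ^ b (Fin.last n) + -X (Sum.inr (Fin.last n)) ^ b i, ?_,
    (principalSymbol_add (hX _ _) (hX _ _).neg (hb (Fin.lt_last_iff_ne_last.mpr hi))
      (pow_ne_zero _ (X_ne_zero _))).symm⟩
  refine Ideal.subset_span (Or.inl ⟨X i ^ b (Fin.last n) - X (Fin.last n) ^ b i, ?_, ?_⟩)
  · refine Ideal.subset_span ⟨Finsupp.single i (b (Fin.last n)), Finsupp.single (Fin.last n) (b i),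
      ?_, by rw [X_pow_eq_monomial, X_pow_eq_monomial]⟩
    funext j
    simp only [Matrix.mulVec, dotProduct, Matrix.of_apply, Finsupp.single_apply, Nat.cast_ite,
      Nat.cast_zero, mul_ite, mul_zero, Finset.sum_ite_eq, Finset.mem_univ, if_true, hab]
    ring
  · rw [constCoeff, LinearMap.comp_apply, AlgHom.toLinearMap_apply, map_sub, map_pow, map_pow,
      rename_X, rename_X, sub_eq_add_neg]

/-- The symbol of the Euler operator lies in the symbol ideal of `H_A(β)`. -/
theorem sum_mem_symbolIdeal {n : ℕ} {a : Fin (n + 1) → ℤ} (ha : a (Fin.last n) ≠ 0)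
    (β : Fin 1 → ℂ) :
    (∑ i, C (a i : ℂ) * (X (Sum.inl i) * X (Sum.inr i)) :
      MvPolynomial (Fin (n + 1) ⊕ Fin (n + 1)) ℂ) ∈
      symbolIdeal (gkzIdeal (Matrix.of fun (_ : Fin 1) (j : Fin (n + 1)) => a j) β) := by
  classical
  have hh : IsWeightedHomogeneous (orderWeight (n + 1))
      (∑ i, C (a i : ℂ) * (X (Sum.inl i) * X (Sum.inr i)) :
        MvPolynomial (Fin (n + 1) ⊕ Fin (n + 1)) ℂ) 1 :=
    IsWeightedHomogeneous.sum _ _ _ fun i _ => by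
      simpa [orderWeight] using ((isWeightedHomogeneous_X ℂ (orderWeight (n + 1)) (Sum.inl i)).mul
        (isWeightedHomogeneous_X ℂ (orderWeight (n + 1)) (Sum.inr i))).C_mul (a i : ℂ)
  have h0 : (∑ i, C (a i : ℂ) * (X (Sum.inl i) * X (Sum.inr i)) :
        MvPolynomial (Fin (n + 1) ⊕ Fin (n + 1)) ℂ) ≠ 0 := by
    intro h
    -- At x = e_n, ξ = (1,…,1) the form takes the value a_n ≠ 0.
    have := congrArg (aeval (Sum.elim (Pi.single (Fin.last n) 1) (fun _ => (1 : ℂ)))) h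
    simp [Pi.single_apply, ha] at this
  refine Ideal.subset_span ⟨_, Ideal.subset_span (Or.inr ⟨0, eulerOperator_eq_normalOrder _ _ _⟩),
    (principalSymbol_add hh (isWeightedHomogeneous_C _ _) one_pos h0).symm⟩

end

/-! ### The characteristic variety and its projection -/

theorem mainTheorem7 (n : ℕ) (a : Fin (n + 1) → ℤ) (ha₁ : a 0 = 1) (ha : StrictMono a) (β : ℂ) :
    WeylAlgebra.charVariety
        (gkzIdeal (Matrix.of fun (_ : Fin 1) (j : Fin (n + 1)) => a j) (fun _ => β)) =
      MvPolynomial.zeroLocus ℂ (Ideal.span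
        ({q : MvPolynomial (Fin (n + 1) ⊕ Fin (n + 1)) ℂ |
            ∃ i : Fin (n + 1), i ≠ Fin.last n ∧ q = MvPolynomial.X (Sum.inr i)} ∪
          {MvPolynomial.X (Sum.inl (Fin.last n)) * MvPolynomial.X (Sum.inr (Fin.last n))})) ∧
    WeylAlgebra.singularLocus
        (gkzIdeal (Matrix.of fun (_ : Fin 1) (j : Fin (n + 1)) => a j) (fun _ => β)) =
      {x : Fin (n + 1) → ℂ | x (Fin.last n) = 0} := by
  have hpos : ∀ i, 0 < a i := fun i => by
    have := ha.monotone (Fin.zero_le i)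
    omega
  obtain ⟨b, hab⟩ : ∃ b : Fin (n + 1) → ℕ, ∀ i, (b i : ℤ) = a i :=
    ⟨fun i => (a i).toNat, fun i => Int.toNat_of_nonneg (hpos i).le⟩
  have hb : StrictMono b := fun i j hij => by
    have := ha hij
    rw [← hab, ← hab] at this
    exact_mod_cast this
  have hb0 : ∀ i, 0 < b i := fun i => by
    have := hpos i
    rw [← hab] at this
    exact_mod_cast this
  have hmem : ∀ z : Fin (n + 1) ⊕ Fin (n + 1) → ℂ, z ∈ WeylAlgebra.charVariety
      (gkzIdeal (Matrix.of fun (_ : Fin 1) (j : Fin (n + 1)) => a j) (fun _ => β)) ↔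
      (∀ i, i ≠ Fin.last n → z (Sum.inr i) = 0) ∧
        z (Sum.inl (Fin.last n)) * z (Sum.inr (Fin.last n)) = 0 := by
    intro z
    constructor
    · intro hz
      have h1 : ∀ i, i ≠ Fin.last n → z (Sum.inr i) = 0 := fun i hi => by
        have := hz _ (X_inr_pow_mem_symbolIdeal hab hb (fun _ => β) hi)
        rw [map_pow, aeval_X] at this
        exact eq_zero_of_pow_eq_zero this
      refine ⟨h1, ?_⟩
      have := hz _ (sum_mem_symbolIdeal (hpos (Fin.last n)).ne' (fun _ => β))
      -- With ξ_i = 0 for i ≠ n, only a_n x_n ξ_n survives.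
      rw [map_sum, Finset.sum_eq_single (Fin.last n)] at this
      · simpa [(hpos (Fin.last n)).ne'] using this
      · intro i _ hi
        simp [h1 i hi]
      · simp
    · rintro ⟨h1, h2⟩
      rw [WeylAlgebra.charVariety, WeylAlgebra.symbolIdeal, zeroLocus_span]
      rintro _ ⟨p, hp, rfl⟩
      exact WeylAlgebra.aeval_principalSymbol_eq_zero hb (hb0 0) β
        (expAction_gkzIdeal_one hab β hp) h1 h2
  constructor
  · ext z
    rw [hmem, zeroLocus_span]
    simp only [Set.mem_ofPred_eq, Set.mem_union, Set.mem_singleton_iff]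
    constructor
    · rintro ⟨h1, h2⟩ p (⟨i, hi, rfl⟩ | rfl)
      · simpa using h1 i hi
      · simpa using h2
    · intro h
      exact ⟨fun i hi => by simpa using h _ (Or.inl ⟨i, hi, rfl⟩), by simpa using h _ (Or.inr rfl)⟩
  · ext y
    constructor
    · rintro ⟨z, ⟨hz, i, hi⟩, rfl⟩
      obtain ⟨h1, h2⟩ := (hmem z).mp hz
      have : i = Fin.last n := by_contra fun h => hi (h1 i h)
      subst this
      exact (mul_eq_zero.mp h2).resolve_right hi
    · intro hy
      -- Over y with y_n = 0 the covector ξ = e_n is characteristic.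
      refine ⟨Sum.elim y (Pi.single (Fin.last n) 1), ⟨(hmem _).mpr ⟨fun i hi => ?_, ?_⟩,
        Fin.last n, by simp⟩, rfl⟩
      · simp [hi]
      · simpa using hy
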